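/- Let $R$ be a commutative local ring (a commutative ring with identity having exactly one maximal ideal $\mathcal M$; $R$ is not assumed Noetherian). A module is simple if it is nonzero and has no submodules other than $0$ and itself. For $x\in R$, $\operatorname{Ann}(x)=\{a\in R: ax=0\}$. A principal ideal ring is a commutative ring (not necessarily a domain, possibly zero) all of whose ideals are principal. The elements $x,y,x',y',z'$ below may be $0$, and index sets may be empty. For a set $\Lambda$ consider the following two conditions. $(3)_\Lambda$ There are elements $x,y\in R$ and a family $(w_\lambda)_{\lambda\in\Lambda}$ in $R$ such that $\mathcal M=Rx\oplus Ry\oplus\bigl(\bigoplus_{\lambda\in\Lambda}Rw_\lambda\bigr)$, each $Rw_\lambda$ is a simple $R$-module, and $R/\operatorname{Ann}(x)$ and $R/\operatorname{Ann}(y)$ are principal ideal rings. $(4)_\Lambda$ For every proper ideal $I$ of $R$ there is a set $\Gamma$ with $|\Gamma|\le|\Lambda|$ such that at least one of the following holds: (i) $I=Rx'\oplus Ry'\oplus\bigl(\bigoplus_{\gamma\in\Gamma}Rw'_\gamma\bigr)$ for some $x',y',w'_\gamma\in R$ such that each $Rw'_\gamma$ is a simple $R$-module and $R/\operatorname{Ann}(x')$,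 $R/\operatorname{Ann}(y')$ are principal ideal rings; (ii) $I=Rz'\oplus\bigl(\bigoplus_{\gamma\in\Gamma}Rw'_\gamma\bigr)$ for some $z',w'_\gamma\in R$ such that each $Rw'_\gamma$ is a simple $R$-module and every ideal of $R/\operatorname{Ann}(z')$ is a direct sum of at most two principal ideals. Theorem. The following statements are equivalent: (1) every ideal of $R$ is a direct sum of cyclic $R$-modules; (2) every ideal of $R$ is a direct sum of cyclic $R$-modules, at most two of which are not simple; (3) $(3)_\Lambda$ holds for some set $\Lambda$; (4) $(4)_\Lambda$ holds for some set $\Lambda$; (5) every ideal of $R$ is isomorphic to a direct summand of a direct sum of cyclic $R$-modules. Moreover, the index sets in (3) and (4) correspond: for every set $\Lambda$, $(3)_\Lambda$ implies $(4)_\Lambda$, and $(4)_\Lambda$ implies $(3)_\Gamma$ for some set $\Gamma$ with $|\Gamma|\le|\Lambda|$. If $(4)_\Lambda$ holds (in particular, if $(3)_\Lambda$ holds), then whenever an ideal of $R$ is written as a direct sum $\bigoplus_{k\in K}Ra_k$ with all $a_k\neq 0$, one has $|K|\le|\Lambda|+2$. -/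

import Mathlib

universe u v

namespace CyclicIdeals

/-- The submodule `N` is the internal direct sum of the cyclic submodules `R • a i`. -/
def IsDirectSumOfSpans {R : Type u} [CommRing R] {M : Type v} [AddCommGroup M] [Module R M]
    (N : Submodule R M) {ι : Type*} (a : ι → M) : Prop :=
  iSupIndep (fun i => Submodule.span R {a i}) ∧ ⨆ i, Submodule.span R {a i} = N

/-- `N` is a direct sum of (arbitrarily many) cyclic modules. -/
def IsDirectSumOfCyclics {R : Type u} [CommRing R] {M : Type v} [AddCommGroup M] [Module R M]
    (N : Submodule R M) : Prop :=
  ∃ (ι : Type v) (a : ι → M), IsDirectSumOfSpans N a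

/-- `N` is a direct sum of cyclic modules, at most two of which are not simple. -/
def IsDirectSumOfCyclicsTwoNonsimple {R : Type u} [CommRing R] {M : Type v} [AddCommGroup M]
    [Module R M] (N : Submodule R M) : Prop :=
  ∃ (ι : Type v) (a : ι → M), IsDirectSumOfSpans N a ∧
    {i | ¬ IsSimpleModule R (Submodule.span R {a i})}.encard ≤ 2

/-- `N` is (isomorphic to) a direct summand of a direct sum of cyclic modules. -/
def IsSummandOfDirectSumOfCyclics {R : Type u} [CommRing R] (N : Type u) [AddCommGroup N]
    [Module R N] : Prop :=
  ∃ (D : Type u) (_ : AddCommGroup D) (_ : Module R D),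
    IsDirectSumOfCyclics (⊤ : Submodule R D) ∧
      ∃ P Q : Submodule R D, IsCompl P Q ∧ Nonempty (N ≃ₗ[R] P)

/-- The annihilator of an element. -/
def ann {R : Type u} [CommRing R] (x : R) : Ideal R :=
  (Submodule.span R {x}).annihilator

/-- `I` is a direct sum of at most two principal ideals (the generators may be zero). -/
def IsDirectSumOfTwoPrincipal {S : Type u} [CommRing S] (I : Ideal S) : Prop :=
  ∃ a b : S, IsDirectSumOfSpans I ![a, b]

/-- `I = Rx ⊕ Ry ⊕ (⨁ Rw_γ)` with `γ` running over `Γ`, every `Rw_γ` simple, and `R/Ann(x)`,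
`R/Ann(y)` principal ideal rings. -/
def HasFormTwo {R : Type u} [CommRing R] (I : Ideal R) (Γ : Type u) : Prop :=
  ∃ (x y : R) (w : Γ → R),
    IsDirectSumOfSpans I (Sum.elim ![x, y] w) ∧
    (∀ γ, IsSimpleModule R (Submodule.span R {w γ})) ∧
    IsPrincipalIdealRing (R ⧸ ann x) ∧ IsPrincipalIdealRing (R ⧸ ann y)

/-- `I = Rz ⊕ (⨁ Rw_γ)` with `γ` running over `Γ`, every `Rw_γ` simple, and every ideal of
`R/Ann(z)` a direct sum of at most two principal ideals. -/
def HasFormOne {R : Type u} [CommRing R] (I : Ideal R) (Γ : Type u) : Prop :=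
  ∃ (z : R) (w : Γ → R),
    IsDirectSumOfSpans I (Sum.elim ![z] w) ∧
    (∀ γ, IsSimpleModule R (Submodule.span R {w γ})) ∧
    ∀ J : Ideal (R ⧸ ann z), IsDirectSumOfTwoPrincipal J

/-- Every proper ideal has one of the two forms, with at most `|Λ|` simple summands `Rw_γ`. -/
def ProperIdealsHaveForms (R : Type u) [CommRing R] (Λ : Type u) : Prop :=
  ∀ I : Ideal R, I ≠ ⊤ →
    ∃ Γ : Type u, Cardinal.mk Γ ≤ Cardinal.mk Λ ∧ (HasFormTwo I Γ ∨ HasFormOne I Γ)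

end CyclicIdeals

/-! Everything passes through one consequence of (5), `HasCyclicSummands`: each nonzero element of
an ideal has a nonzero component in a cyclic direct summand. It holds because an endomorphism of a
cyclic module is multiplication by a scalar `a`, and over a local ring `a` or `1 - a` is a unit;
this is the exchange argument behind Krull–Schmidt theorems (`exists_bijective_comp`,
`exists_cyclic_summand`).

For (5) ⇒ (3), split off from `𝓜` cyclic summands not killed by `𝓜`. Three of them, `Rx`, `Ry`,
`Rz`, cannot occur, since the ideal `(x + y, y + z)` would violate the property
(`not_hasCyclicSummands_span_pair`). Hence `𝓜 = Rx ⊕ Ry ⊕ S` with `𝓜S = 0`, and `S` is a vector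
space over the residue field. Since products across summands vanish, `𝓜x = Rx²`. The property also
gives `P = 𝓜P ⇒ P = 0` without finite generation, so `⋂ Rxⁿ = 0`, and the nonzero ideals inside `Rx`
are generated by powers of `x`.

For (3) ⇒ (4), project `I ⊆ 𝓜` to `Rx` and `Ry`, with images `Rp` and `Rq`. Then `𝓜p` and `𝓜q` lie
in `I`, so modulo `S` the ideal is either `Rp ⊕ Rq` or generated by one element `p + bq` with `b` a
unit (`exists_isTripleSum_of_le`). These are the forms (i) and (ii). The bound on the number of
summands is a dimension count in `I / 𝓜I`. -/

namespace CyclicIdeals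

open IsLocalRing Submodule

/-! ### Internal direct sums of cyclic submodules. -/

section General

variable {R : Type u} [CommRing R] {M : Type v} [AddCommGroup M] [Module R M]

theorem iSupIndep_span_singleton_iff {ι : Type*} (a : ι → M) :
    iSupIndep (fun i => span R {a i}) ↔
      ∀ (s : Finset ι) (r : ι → R), ∑ i ∈ s, r i • a i = 0 → ∀ i ∈ s, r i • a i = 0 := by
  rw [iSupIndep_iff_finsetSum_eq_zero_imp_eq_zero]
  constructor
  · intro h s r h0
    exact h s (fun i => r i • a i) (fun i _ => smul_mem _ _ (mem_span_singleton_self _)) h0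
  · intro h s v hv h0 i hi
    have hv' : ∀ i, ∃ r : R, i ∈ s → r • a i = v i := fun i => by
      by_cases his : i ∈ s
      · obtain ⟨r, hr⟩ := mem_span_singleton.mp (hv i his)
        exact ⟨r, fun _ => hr⟩
      · exact ⟨0, fun h => absurd h his⟩
    choose r hr using hv'
    rw [← hr i hi]
    refine h s r ?_ i hi
    rw [← h0]
    exact Finset.sum_congr rfl fun i hi => hr i hi

theorem IsDirectSumOfSpans.mem {N : Submodule R M} {ι : Type*} {a : ι → M}
    (h : IsDirectSumOfSpans N a) (i : ι) : a i ∈ N :=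
  h.2 ▸ mem_iSup_of_mem (p := fun i => span R {a i}) i (mem_span_singleton_self _)

theorem IsDirectSumOfSpans.span_range {N : Submodule R M} {ι : Type*} {a : ι → M}
    (h : IsDirectSumOfSpans N a) : span R (Set.range a) = N := by
  rw [span_range_eq_iSup, h.2]

theorem isDirectSumOfSpans_sumElim_iff {N : Submodule R M} {α β : Type*} {a : α → M} {b : β → M} :
    IsDirectSumOfSpans N (Sum.elim a b) ↔ ∃ A B : Submodule R M,
      IsDirectSumOfSpans A a ∧ IsDirectSumOfSpans B b ∧ Disjoint A B ∧ A ⊔ B = N := by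
  constructor
  · rintro ⟨hi, hs⟩
    refine ⟨_, _, ⟨hi.comp (f := Sum.inl) Sum.inl_injective, rfl⟩,
      ⟨hi.comp (f := Sum.inr) Sum.inr_injective, rfl⟩, ?_, ?_⟩
    · have := hi.disjoint_biSup_biSup (s := Set.range Sum.inl) (t := Set.range Sum.inr)
        Set.isCompl_range_inl_range_inr.disjoint
      rwa [iSup_range, iSup_range] at this
    · rw [← hs, iSup_sum]; rfl
  · rintro ⟨A, B, ⟨hA, hA'⟩, ⟨hB, hB'⟩, hd, hs⟩
    refine ⟨?_, ?_⟩
    · rw [iSupIndep_span_singleton_iff] at *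
      intro s r h0
      rw [Finset.sum_sum_eq_sum_toLeft_add_sum_toRight] at h0
      simp only [Sum.elim_inl, Sum.elim_inr] at h0
      have h1 : ∑ i ∈ s.toLeft, r (Sum.inl i) • a i ∈ A :=
        sum_mem fun i _ => smul_mem _ _ (IsDirectSumOfSpans.mem
          ⟨(iSupIndep_span_singleton_iff a).2 hA, hA'⟩ i)
      have h2 : ∑ i ∈ s.toRight, r (Sum.inr i) • b i ∈ B :=
        sum_mem fun i _ => smul_mem _ _ (IsDirectSumOfSpans.mem
          ⟨(iSupIndep_span_singleton_iff b).2 hB, hB'⟩ i)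
      have h3 := Submodule.disjoint_def.mp hd _ h1
        (by rw [eq_neg_of_add_eq_zero_left h0]; exact neg_mem h2)
      rw [h3, zero_add] at h0
      rintro (i | i) hi
      · exact hA _ (fun i => r (Sum.inl i)) h3 i (by simpa using hi)
      · exact hB _ (fun i => r (Sum.inr i)) h0 i (by simpa using hi)
    · rw [iSup_sum]
      simp only [Sum.elim_inl, Sum.elim_inr]
      rw [hA', hB', hs]

theorem isDirectSumOfSpans_pair_iff {N : Submodule R M} {x y : M} :
    IsDirectSumOfSpans N ![x, y] ↔
      Disjoint (span R {x}) (span R {y}) ∧ span R {x} ⊔ span R {y} = N := by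
  unfold IsDirectSumOfSpans
  rw [iSupIndep_pair (i := 0) (j := 1) (by decide) (by decide)]
  have : ⨆ i, span R {(![x, y] : Fin 2 → M) i} = span R {x} ⊔ span R {y} := by
    apply le_antisymm
    · refine iSup_le fun i => ?_
      fin_cases i
      · exact le_sup_left
      · exact le_sup_right
    · exact sup_le (le_iSup (fun i => span R {(![x, y] : Fin 2 → M) i}) 0)
        (le_iSup (fun i => span R {(![x, y] : Fin 2 → M) i}) 1)
  rw [this]
  rfl

theorem isDirectSumOfSpans_unique_iff {N : Submodule R M} {ι : Type*} [Unique ι] {a : ι → M} :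
    IsDirectSumOfSpans N a ↔ span R {a default} = N := by
  unfold IsDirectSumOfSpans
  rw [iSup_unique]
  exact ⟨fun h => h.2, fun h => ⟨iSupIndep_subsingleton _, h⟩⟩

theorem isDirectSumOfSpans_map_iff {M' : Type*} [AddCommGroup M'] [Module R M'] (f : M →ₗ[R] M')
    (hf : Function.Injective f) {N : Submodule R M} {ι : Type*} {a : ι → M} :
    IsDirectSumOfSpans (N.map f) (fun i => f (a i)) ↔ IsDirectSumOfSpans N a := by
  unfold IsDirectSumOfSpans
  refine and_congr ?_ ?_
  · rw [iSupIndep_span_singleton_iff, iSupIndep_span_singleton_iff]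
    refine forall₂_congr fun s r => ?_
    simp only [← map_smul, ← map_sum, map_eq_zero_iff f hf]
  · rw [← (Submodule.map_injective_of_injective hf).eq_iff, Submodule.map_iSup]
    simp [Submodule.map_span]

end General

/-! ### Ideals of `R ⧸ ann x` as ideals of `R` inside `Rx`. -/

section Quotient

variable {R : Type u} [CommRing R]

theorem mem_ann {x a : R} : a ∈ ann x ↔ a * x = 0 := by
  simp [ann]

/-- The isomorphism `R ⧸ ann x ≃ Rx`, restricted to an injection into `R`. -/
noncomputable def quotientAnnToRing (x : R) : (R ⧸ ann x) →ₗ[R] R :=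
  (ann x).liftQ (LinearMap.toSpanSingleton R R x) fun a ha => by
    simpa using mem_ann.mp ha

theorem quotientAnnToRing_mk (x a : R) :
    quotientAnnToRing x (Ideal.Quotient.mk (ann x) a) = a * x := rfl

theorem quotientAnnToRing_injective (x : R) : Function.Injective (quotientAnnToRing x) := by
  rw [injective_iff_map_eq_zero]
  intro a
  obtain ⟨a, rfl⟩ := Ideal.Quotient.mk_surjective a
  rw [quotientAnnToRing_mk, ← mem_ann, Ideal.Quotient.eq_zero_iff_mem]
  exact id

theorem restrictScalars_span_quotient {I : Ideal R} (s : Set (R ⧸ I)) :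
    (span (R ⧸ I) s).restrictScalars R = span R s :=
  restrictScalars_span R (R ⧸ I) Ideal.Quotient.mk_surjective s

theorem isDirectSumOfSpans_quotient_iff {I : Ideal R} {J : Ideal (R ⧸ I)} {ι : Type*}
    {a : ι → R ⧸ I} :
    IsDirectSumOfSpans J a ↔ IsDirectSumOfSpans (J.restrictScalars R) a := by
  unfold IsDirectSumOfSpans
  refine and_congr ?_ ?_
  · rw [iSupIndep_span_singleton_iff, iSupIndep_span_singleton_iff]
    constructor
    · intro h s r h0
      exact h s (fun i => Ideal.Quotient.mk I (r i)) h0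
    · intro h s r h0
      choose r' hr' using fun i => Ideal.Quotient.mk_surjective (r i)
      obtain rfl : (fun i => Ideal.Quotient.mk I (r' i)) = r := funext hr'
      exact h s r' h0
  · rw [← span_range_eq_iSup, ← span_range_eq_iSup, ← restrictScalars_span_quotient,
      (restrictScalars_injective R (R ⧸ I) (R ⧸ I)).eq_iff]

/-- A property of the sub-`R`-modules of `Rx` stated in terms of direct sums of spans corresponds
to the same property of the ideals of `R ⧸ ann x`. -/
theorem forall_ideal_quotient_ann_iff (x : R) (n : ℕ) :
    (∀ J : Ideal (R ⧸ ann x), ∃ a : Fin n → R ⧸ ann x, IsDirectSumOfSpans J a) ↔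
      ∀ J : Ideal R, J ≤ span R {x} → ∃ a : Fin n → R, IsDirectSumOfSpans J a := by
  constructor
  · intro h J hJ
    let K : Ideal (R ⧸ ann x) :=
      { Submodule.comap (quotientAnnToRing x) J with
        smul_mem' := fun c y hy => by
          obtain ⟨c, rfl⟩ := Ideal.Quotient.mk_surjective c
          exact (Submodule.comap (quotientAnnToRing x) J).smul_mem c hy }
    obtain ⟨a, ha⟩ := h K
    refine ⟨fun i => quotientAnnToRing x (a i), ?_⟩
    have hK : (K.restrictScalars R).map (quotientAnnToRing x) = J := by
      change (Submodule.comap (quotientAnnToRing x) J).map (quotientAnnToRing x) = J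
      rw [map_comap_eq_of_le]
      intro y hy
      obtain ⟨r, rfl⟩ := mem_span_singleton.mp (hJ hy)
      exact ⟨Ideal.Quotient.mk _ r, rfl⟩
    rw [← hK, isDirectSumOfSpans_map_iff _ (quotientAnnToRing_injective x)]
    exact isDirectSumOfSpans_quotient_iff.mp ha
  · intro h J
    have hle : (J.restrictScalars R).map (quotientAnnToRing x) ≤ span R {x} := by
      rintro _ ⟨y, -, rfl⟩
      obtain ⟨y, rfl⟩ := Ideal.Quotient.mk_surjective y
      exact mem_span_singleton.mpr ⟨y, rfl⟩
    obtain ⟨b, hb⟩ := h _ hle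
    have hb' : ∀ i, ∃ a, quotientAnnToRing x a = b i := fun i => by
      obtain ⟨y, -, hy⟩ := hb.mem i
      exact ⟨y, hy⟩
    choose a ha using hb'
    obtain rfl : (fun i => quotientAnnToRing x (a i)) = b := funext ha
    rw [isDirectSumOfSpans_map_iff _ (quotientAnnToRing_injective x)] at hb
    exact ⟨a, isDirectSumOfSpans_quotient_iff.mpr hb⟩

/-- The case of one generator in the correspondence given by `Rx ≅ R ⧸ ann x`. It keeps all later
arguments inside `R`. -/
theorem isPrincipalIdealRing_quotient_ann_iff (x : R) :
    IsPrincipalIdealRing (R ⧸ ann x) ↔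
      ∀ J : Ideal R, J ≤ span R {x} → ∃ a, J = span R {a} := by
  have key := forall_ideal_quotient_ann_iff x 1
  simp only [isDirectSumOfSpans_unique_iff] at key
  constructor
  · intro h J hJ
    obtain ⟨a, ha⟩ := key.mp (fun J => by
      obtain ⟨a, ha⟩ := (h.principal J).principal
      exact ⟨fun _ => a, ha.symm⟩) J hJ
    exact ⟨_, ha.symm⟩
  · intro h
    refine ⟨fun J => ⟨?_⟩⟩
    obtain ⟨a, ha⟩ := key.mpr (fun J hJ => by
      obtain ⟨a, ha⟩ := h J hJ
      exact ⟨fun _ => a, ha.symm⟩) J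
    exact ⟨_, ha.symm⟩

theorem forall_isDirectSumOfTwoPrincipal_quotient_ann (x : R)
    (h : ∀ J : Ideal R, J ≤ span R {x} →
      ∃ a b, Disjoint (span R {a}) (span R {b}) ∧ span R {a} ⊔ span R {b} = J)
    (J : Ideal (R ⧸ ann x)) : IsDirectSumOfTwoPrincipal J := by
  obtain ⟨a, ha⟩ := (forall_ideal_quotient_ann_iff x 2).mpr (fun J hJ => by
      obtain ⟨a, b, hab⟩ := h J hJ
      exact ⟨_, isDirectSumOfSpans_pair_iff.mpr hab⟩) J
  refine ⟨a 0, a 1, ?_⟩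
  rwa [show ![a 0, a 1] = a from funext fun i => by fin_cases i <;> rfl]

end Quotient

/-! ### Simple summands and numbers of generators over a local ring. -/

section Local

variable {R : Type u} [CommRing R] [IsLocalRing R]

theorem isSimpleModule_span_singleton_iff {w : R} :
    IsSimpleModule R (span R {w}) ↔ w ≠ 0 ∧ ∀ r ∈ maximalIdeal R, r * w = 0 := by
  constructor
  · intro h
    refine ⟨?_, ?_⟩
    · rintro rfl
      have := h.nontrivial
      rw [nontrivial_iff_ne_bot] at this
      simp at this
    · intro r hr
      have hmax := IsSimpleModule.annihilator_isMaximal (R := R) (M := span R {w})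
      rw [← IsLocalRing.eq_maximalIdeal hmax] at hr
      exact mem_ann.mp hr
  · rintro ⟨hw, hm⟩
    rw [isSimpleModule_iff_isAtom]
    refine ⟨by simpa using hw, fun N hN => ?_⟩
    rw [eq_bot_iff]
    intro y hy
    obtain ⟨r, rfl⟩ := mem_span_singleton.mp (hN.le hy)
    by_cases hr : r ∈ maximalIdeal R
    · simp [hm r hr]
    · exfalso
      refine hN.not_ge ?_
      rw [span_singleton_le_iff_mem]
      exact (N.smul_mem_iff_of_isUnit (by simpa using hr)).mp hy

/-- A submodule of a module generated by a family of elements killed by the maximal ideal is a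
direct sum of at most as many simple modules. -/
theorem exists_isDirectSumOfSpans_simple {Λ : Type u} (w : Λ → R)
    (hw : ∀ r ∈ maximalIdeal R, ∀ l, r * w l = 0) {S : Ideal R}
    (hS : S ≤ span R (Set.range w)) :
    ∃ (Γ : Type u) (w' : Γ → R), Cardinal.mk Γ ≤ Cardinal.mk Λ ∧ IsDirectSumOfSpans S w' ∧
      ∀ γ, IsSimpleModule R (span R {w' γ}) := by
  let _ := Ideal.Quotient.field (maximalIdeal R)
  -- `T` is the annihilator of the maximal ideal, a vector space over the residue field. A basis of
  -- the subspace given by `S` supplies the simple summands, and its size is at most the dimension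
  -- of the span of `w`.
  let T := torsionBySet R R (maximalIdeal R : Set R)
  have hwT : ∀ l, w l ∈ T := fun l => by
    rw [mem_torsionBySet_iff]
    exact fun a => hw a a.2 l
  have hST : S ≤ T := hS.trans (span_le.mpr (by rintro _ ⟨l, rfl⟩; exact hwT l))
  let U : Submodule (R ⧸ maximalIdeal R) T :=
    { Submodule.comap T.subtype S with
      smul_mem' := fun c y hy => by
        obtain ⟨c, rfl⟩ := Ideal.Quotient.mk_surjective c
        exact (Submodule.comap T.subtype S).smul_mem c hy }
  have hU : (U.restrictScalars R).map T.subtype = S := by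
    change Submodule.map T.subtype (Submodule.comap T.subtype S) = S
    rw [map_comap_eq_of_le (by simpa using hST)]
  have hUw : U ≤ span (R ⧸ maximalIdeal R) (Set.range fun l => (⟨w l, hwT l⟩ : T)) := by
    change U.restrictScalars R ≤ (span (R ⧸ maximalIdeal R) _).restrictScalars R
    rw [restrictScalars_span R (R ⧸ maximalIdeal R) Ideal.Quotient.mk_surjective,
      ← map_le_map_iff_of_injective T.injective_subtype, hU, map_span, ← Set.range_comp]
    exact hS
  let b := Module.Basis.ofVectorSpace (R ⧸ maximalIdeal R) U
  have hb0 : ∀ i, ((b i : T) : R) ≠ 0 := fun i => by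
    simpa using b.ne_zero i
  refine ⟨_, fun i => ((b i : T) : R), ?_, ⟨?_, ?_⟩, ?_⟩
  · rw [b.mk_eq_rank'']
    refine (Submodule.rank_mono hUw).trans ((rank_span_le _).trans ?_)
    exact Cardinal.mk_range_le
  · rw [iSupIndep_span_singleton_iff]
    intro s r h0 i hi
    have h1 : ∑ i ∈ s, Ideal.Quotient.mk (maximalIdeal R) (r i) • b i = 0 := by
      apply Subtype.ext
      apply Subtype.ext
      simpa using h0
    have h2 := linearIndependent_iff'.mp b.linearIndependent s _ h1 i hi
    rw [Ideal.Quotient.eq_zero_iff_mem] at h2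
    exact (mem_torsionBySet_iff _ _).mp (b i : T).2 ⟨_, h2⟩
  · have h1 : span (R ⧸ maximalIdeal R) (Set.range fun i => (b i : T)) = U := by
      have := congrArg (Submodule.map U.subtype) b.span_eq
      rwa [map_span, ← Set.range_comp, Submodule.map_subtype_top] at this
    have h2 := congrArg (fun V => (V.restrictScalars R).map T.subtype) h1
    rw [restrictScalars_span R (R ⧸ maximalIdeal R) Ideal.Quotient.mk_surjective,
      map_span, ← Set.range_comp, hU] at h2
    rw [← span_range_eq_iSup]
    exact h2
  · intro i
    rw [isSimpleModule_span_singleton_iff]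
    exact ⟨hb0 i, fun r hr => (mem_torsionBySet_iff _ _).mp (b i : T).2 ⟨r, hr⟩⟩

/-- In `I / 𝓜I`, a vector space over the residue field, the `a k` are linearly independent while the
`b i` span. -/
theorem mk_le_of_isDirectSumOfSpans {I : Ideal R} {κ ι : Type u} {a : κ → R}
    (ha : IsDirectSumOfSpans I a) (h0 : ∀ k, a k ≠ 0) {b : ι → R}
    (hb : span R (Set.range b) = I) : Cardinal.mk κ ≤ Cardinal.mk ι := by
  classical
  let _ := Ideal.Quotient.field (maximalIdeal R)
  let V := ↥I ⧸ (maximalIdeal R • ⊤ : Submodule R I)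
  have hbI : ∀ i, b i ∈ I := fun i => hb ▸ subset_span ⟨i, rfl⟩
  have hspan : span (R ⧸ maximalIdeal R)
      (Set.range fun i => (Submodule.Quotient.mk ⟨b i, hbI i⟩ : V)) = ⊤ := by
    apply restrictScalars_injective R
    rw [restrictScalars_span R (R ⧸ maximalIdeal R) Ideal.Quotient.mk_surjective]
    have h1 : span R (Set.range fun i => (⟨b i, hbI i⟩ : I)) = ⊤ := by
      apply map_injective_of_injective I.injective_subtype
      rw [map_span, ← Set.range_comp, map_subtype_top]
      exact hb
    have h2 := congrArg (Submodule.map (mkQ (maximalIdeal R • ⊤ : Submodule R I))) h1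
    rw [map_span, ← Set.range_comp, Submodule.map_top, range_mkQ] at h2
    exact h2
  have hli : LinearIndependent (R ⧸ maximalIdeal R)
      (fun k => (Submodule.Quotient.mk ⟨a k, ha.mem k⟩ : V)) := by
    rw [linearIndependent_iff']
    intro s g hg i hi
    choose r hr using fun i => Ideal.Quotient.mk_surjective (g i)
    obtain rfl : (fun i => Ideal.Quotient.mk _ (r i)) = g := funext hr
    change ∑ i ∈ s, mkQ (maximalIdeal R • ⊤ : Submodule R I) (r i • ⟨a i, ha.mem i⟩) = 0 at hg
    rw [← map_sum, mkQ_apply, Submodule.Quotient.mk_eq_zero] at hg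
    have hg' := mem_map_of_mem (f := I.subtype) hg
    rw [map_smul'', map_subtype_top] at hg'
    have hg'' : ∑ k ∈ s, r k • a k ∈ maximalIdeal R • span R (Set.range a) := by
      rw [ha.span_range]
      simpa using hg'
    obtain ⟨c, hc, hc'⟩ := (mem_ideal_smul_span_iff_exists_sum _ a _).mp hg''
    -- The same element is written with coefficients `r` and with coefficients `c` in `𝓜`.
    -- Directness gives `(r i - c i) • a i = 0`, and `r i - c i` would be a unit if `r i` were one.
    have h1 : ∑ k ∈ s ∪ c.support, ((if k ∈ s then r k else 0) - c k) • a k = 0 := by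
      simp only [sub_smul, Finset.sum_sub_distrib, ite_smul, zero_smul]
      rw [Finset.sum_ite_mem, Finset.union_inter_cancel_left,
        ← c.sum_of_support_subset Finset.subset_union_right (fun i r => r • a i) (by simp), hc']
      simp
    have h2 := (iSupIndep_span_singleton_iff a).mp ha.1 _ _ h1 i (Finset.mem_union_left _ hi)
    rw [if_pos hi] at h2
    rw [Ideal.Quotient.eq_zero_iff_mem]
    by_contra hri
    have h3 : IsUnit (r i - c i) := by
      by_contra h3
      exact hri (by simpa using add_mem ((mem_maximalIdeal _).mpr h3) (hc i))
    exact h0 i (h3.mul_right_eq_zero.mp h2)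
  refine hli.cardinal_le_rank.trans ?_
  rw [← rank_top, ← hspan]
  exact (rank_span_le _).trans Cardinal.mk_range_le

end Local

/-! ### Cyclic summands of summands of direct sums of cyclic modules. -/

section Summand

variable {R : Type u} [CommRing R] [IsLocalRing R]

/-- Since `R` is commutative, `φ` is multiplication by the scalar `a` with `φ c = a • c`, and `a` or
`1 - a` is a unit. -/
theorem bijective_or_bijective_one_sub {C : Type*} [AddCommGroup C] [Module R C] {c : C}
    (hc : span R {c} = ⊤) (φ : C →ₗ[R] C) :
    Function.Bijective φ ∨ Function.Bijective (LinearMap.id - φ : C →ₗ[R] C) := by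
  have hC : ∀ y, ∃ r : R, r • c = y := fun y => mem_span_singleton.mp (hc ▸ mem_top)
  obtain ⟨a, ha⟩ := hC (φ c)
  have hφ : ∀ y, φ y = a • y := fun y => by
    obtain ⟨r, rfl⟩ := hC y
    rw [map_smul, ← ha, smul_comm]
  have hbij : ∀ (b : R) (ψ : C →ₗ[R] C), IsUnit b → (∀ y, ψ y = b • y) → Function.Bijective ψ := by
    intro b ψ hb h
    rw [show (ψ : C → C) = fun y => b • y from funext h]
    obtain ⟨u, rfl⟩ := hb
    exact MulAction.bijective u
  rcases isUnit_or_isUnit_one_sub_self a with h | h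
  · exact Or.inl (hbij a φ h hφ)
  · exact Or.inr (hbij (1 - a) _ h fun y => by simp [hφ, sub_smul])

/-- Induction on the number of terms in `x = ∑ g i (f i x)`. A term with `f j ∘ g j` not bijective
can be absorbed into the others, and the sum cannot become empty because `x ≠ 0`. -/
theorem exists_bijective_comp {N : Type*} [AddCommGroup N] [Module R N] {ι : Type*}
    {C : ι → Type*} [∀ i, AddCommGroup (C i)] [∀ i, Module R (C i)]
    (hC : ∀ i, ∃ c : C i, span R {c} = ⊤) (f : ∀ i, N →ₗ[R] C i) {x : N} (hx : x ≠ 0)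
    (s : Finset ι) (g : ∀ i, C i →ₗ[R] N) (hs : ∑ i ∈ s, g i (f i x) = x) :
    ∃ (i : ι) (g' : C i →ₗ[R] N), Function.Bijective (f i ∘ₗ g') ∧ f i x ≠ 0 := by
  classical
  induction s using Finset.induction_on generalizing g with
  | empty => exact absurd hs.symm (by simpa using hx)
  | insert j s hj ih =>
    rw [Finset.sum_insert hj] at hs
    by_cases hfx : f j x = 0
    · exact ih g (by simpa [hfx] using hs)
    · obtain ⟨c, hc⟩ := hC j
      rcases bijective_or_bijective_one_sub hc (f j ∘ₗ g j) with h | h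
      · exact ⟨j, g j, h, hfx⟩
      · let u := LinearEquiv.ofBijective _ h
        -- Here `u = 1 - f j ∘ g j`. Applying `f j` to the remaining sum gives `u (f j x)`, so `g j
        -- (f j x)` is recovered from that sum through `g j ∘ u⁻¹ ∘ f j`.
        refine ih (fun i => g i + g j ∘ₗ u.symm.toLinearMap ∘ₗ f j ∘ₗ g i) ?_
        have h1 : f j (∑ i ∈ s, g i (f i x)) = u (f j x) := by
          have : ∑ i ∈ s, g i (f i x) = x - g j (f j x) := eq_sub_of_add_eq' hs
          rw [this]
          simp [u]
        have h2 : ∑ i ∈ s, g j (u.symm (f j (g i (f i x)))) = g j (f j x) := by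
          rw [← map_sum, ← map_sum, ← map_sum, h1, u.symm_apply_apply]
        simp only [LinearMap.add_apply, LinearMap.comp_apply, LinearEquiv.coe_coe,
          Finset.sum_add_distrib, h2]
        rwa [add_comm]

/-- If `f i ∘ g'` is bijective, then `N = range g' ⊕ ker (f i)`. The range is cyclic, and `f i x ≠
0` says that `x` is outside the complement. -/
theorem exists_cyclic_summand {N : Type u} [AddCommGroup N] [Module R N]
    (h : IsSummandOfDirectSumOfCyclics (R := R) N) {x : N} (hx : x ≠ 0) :
    ∃ (c : N) (N' : Submodule R N), IsCompl (span R {c}) N' ∧ x ∉ N' := by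
  classical
  obtain ⟨D, _, _, ⟨ι, a, ha⟩, P, Q, hPQ, ⟨θ⟩⟩ := h
  let e := ha.1.linearEquiv ha.2
  have hC : ∀ i, ∃ c : span R {a i}, span R {c} = ⊤ := fun i =>
    ⟨⟨a i, mem_span_singleton_self _⟩, by
      apply map_injective_of_injective (span R {a i}).injective_subtype
      rw [map_span, map_subtype_top, Set.image_singleton]
      rfl⟩
  let f : ∀ i, N →ₗ[R] span R {a i} := fun i =>
    DFinsupp.lapply i ∘ₗ e.symm.toLinearMap ∘ₗ P.subtype ∘ₗ θ.toLinearMap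
  let π : D →ₗ[R] N := θ.symm.toLinearMap ∘ₗ P.projectionOnto Q hPQ
  let g : ∀ i, span R {a i} →ₗ[R] N := fun i => π ∘ₗ (span R {a i}).subtype
  have hsum (d : Π₀ i, span R {a i}) : ∑ i ∈ d.support, g i (d i) = π (e d) := by
    rw [iSupIndep.linearEquiv_apply, DFinsupp.sumAddHom_apply, DFinsupp.sum, map_sum]
    rfl
  have hx' : ∑ i ∈ (e.symm (θ x)).support, g i (f i x) = x := by
    refine (hsum _).trans ?_
    rw [e.apply_symm_apply]
    simp [π]
  obtain ⟨i, g', hbij, hfx⟩ := exists_bijective_comp hC f hx _ g hx'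
  obtain ⟨c, hc⟩ := hC i
  refine ⟨g' c, LinearMap.ker (f i), ?_, by simpa using hfx⟩
  have hr : span R {g' c} = LinearMap.range g' := by
    rw [← Submodule.map_top, ← hc, map_span, Set.image_singleton]
  rw [hr]
  constructor
  · rw [Submodule.disjoint_def]
    rintro _ ⟨y, rfl⟩ hy
    rw [hbij.1 (a₁ := y) (a₂ := 0) (by simpa using hy), map_zero]
  · rw [codisjoint_iff, eq_top_iff]
    intro y _
    obtain ⟨z, hz⟩ := hbij.2 (f i y)
    rw [← add_sub_cancel (g' z) y]
    exact add_mem (mem_sup_left ⟨z, rfl⟩) (mem_sup_right (by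
      rw [LinearMap.mem_ker, map_sub, ← hz]; simp))

/-- Every nonzero element of `N` has a nonzero component in some cyclic direct summand. -/
def HasCyclicSummands (N : Ideal R) : Prop :=
  ∀ x ∈ N, x ≠ 0 → ∃ (c : R) (N' : Ideal R),
    Disjoint (span R {c}) N' ∧ span R {c} ⊔ N' = N ∧ x ∉ N'

theorem hasCyclicSummands_of_isSummand {N : Ideal R}
    (h : IsSummandOfDirectSumOfCyclics (R := R) N) : HasCyclicSummands N := by
  intro x hx hx0
  obtain ⟨c, N', hc, hxN⟩ := exists_cyclic_summand h (x := ⟨x, hx⟩) (by simpa using hx0)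
  have hs : span R {(c : R)} = (span R {c}).map N.subtype := by
    rw [map_span, Set.image_singleton]; rfl
  refine ⟨c, N'.map N.subtype, ?_, ?_, ?_⟩
  · rw [hs]
    exact Submodule.disjoint_map N.injective_subtype hc.disjoint
  · rw [hs, ← Submodule.map_sup, hc.sup_eq_top, map_subtype_top]
  · simpa using fun _ => hxN

end Summand

theorem IsDirectSumOfCyclics.isSummand {R : Type u} [CommRing R] {I : Ideal R}
    (h : IsDirectSumOfCyclics I) : IsSummandOfDirectSumOfCyclics (R := R) I := by
  obtain ⟨ι, a, ha⟩ := h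
  refine ⟨I, inferInstance, inferInstance, ⟨ι, fun i => ⟨a i, ha.mem i⟩, ?_⟩, ⊤, ⊥,
    isCompl_top_bot, ⟨(topEquiv).symm⟩⟩
  rw [← isDirectSumOfSpans_map_iff I.subtype I.injective_subtype, map_subtype_top]
  exact ha

/-- `I = Rx ⊕ Ry ⊕ S`, in terms of elements. -/
structure IsTripleSum {R : Type u} [CommRing R] (x y : R) (S I : Ideal R) : Prop where
  indep : ∀ r s, ∀ t ∈ S, r * x + s * y + t = 0 → r * x = 0 ∧ s * y = 0 ∧ t = 0
  mem_iff : ∀ i, i ∈ I ↔ ∃ r s, ∃ t ∈ S, i = r * x + s * y + t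

/-! ### Decompositions `I = Rx ⊕ Ry ⊕ S` in terms of elements. -/

namespace IsTripleSum

variable {R : Type u} [CommRing R] {x y : R} {S I : Ideal R}

theorem left_mem (h : IsTripleSum x y S I) : x ∈ I :=
  (h.mem_iff x).mpr ⟨1, 0, 0, S.zero_mem, by ring⟩

theorem le (h : IsTripleSum x y S I) : S ≤ I :=
  fun t ht => (h.mem_iff t).mpr ⟨0, 0, t, ht, by ring⟩

/-- The product lies in both `Rx` and `Ry`. The same reason makes every product across distinct
summands vanish. -/
theorem mul_eq_zero (h : IsTripleSum x y S I) : x * y = 0 := by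
  have := (h.indep y (-x) 0 S.zero_mem (by ring)).1
  rwa [mul_comm]

theorem left_mul_eq_zero (h : IsTripleSum x y S I) {t : R} (ht : t ∈ S) : x * t = 0 := by
  have := (h.indep t 0 (-x * t) (S.mul_mem_left _ ht) (by ring)).1
  rwa [mul_comm]

theorem symm (h : IsTripleSum x y S I) : IsTripleSum y x S I where
  indep r s t ht h0 := by
    obtain ⟨h1, h2, h3⟩ := h.indep s r t ht (by rw [← h0]; ring)
    exact ⟨h2, h1, h3⟩
  mem_iff i := by
    rw [h.mem_iff]
    constructor
    · rintro ⟨r, s, t, ht, rfl⟩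
      exact ⟨s, r, t, ht, by ring⟩
    · rintro ⟨r, s, t, ht, rfl⟩
      exact ⟨s, r, t, ht, by ring⟩

theorem right_mul_eq_zero (h : IsTripleSum x y S I) {t : R} (ht : t ∈ S) : y * t = 0 :=
  h.symm.left_mul_eq_zero ht

end IsTripleSum

section

variable {R : Type u} [CommRing R]

theorem mem_span_sup_span_sup_iff {x y i : R} {S : Ideal R} :
    i ∈ span R {x} ⊔ span R {y} ⊔ S ↔ ∃ r s, ∃ t ∈ S, i = r * x + s * y + t := by
  constructor
  · intro hi
    obtain ⟨p, hp, t, ht, rfl⟩ := mem_sup.mp hi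
    obtain ⟨u, hu, v, hv, rfl⟩ := mem_sup.mp hp
    obtain ⟨r, rfl⟩ := mem_span_singleton.mp hu
    obtain ⟨s, rfl⟩ := mem_span_singleton.mp hv
    exact ⟨r, s, t, ht, by simp only [smul_eq_mul]⟩
  · rintro ⟨r, s, t, ht, rfl⟩
    exact add_mem_sup (add_mem_sup (mem_span_singleton.mpr ⟨r, rfl⟩)
      (mem_span_singleton.mpr ⟨s, rfl⟩)) ht

theorem isTripleSum_iff {x y : R} {S I : Ideal R} :
    IsTripleSum x y S I ↔ Disjoint (span R {x}) (span R {y}) ∧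
      Disjoint (span R {x} ⊔ span R {y}) S ∧ span R {x} ⊔ span R {y} ⊔ S = I := by
  constructor
  · intro h
    refine ⟨?_, ?_, ?_⟩
    · rw [Submodule.disjoint_def]
      rintro _ hx hy
      obtain ⟨r, rfl⟩ := mem_span_singleton.mp hx
      obtain ⟨s, hs⟩ := mem_span_singleton.mp hy
      simp only [smul_eq_mul] at *
      exact (h.indep r (-s) 0 S.zero_mem (by rw [← hs]; ring)).1
    · rw [Submodule.disjoint_def]
      intro t hxy ht
      obtain ⟨u, hu, v, hv, rfl⟩ := mem_sup.mp hxy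
      obtain ⟨r, rfl⟩ := mem_span_singleton.mp hu
      obtain ⟨s, rfl⟩ := mem_span_singleton.mp hv
      have := (h.indep r s _ (S.neg_mem ht) (by simp only [smul_eq_mul]; ring)).2.2
      rw [← neg_eq_zero]
      exact this
    · ext i
      rw [h.mem_iff, mem_span_sup_span_sup_iff]
  · rintro ⟨h1, h2, rfl⟩
    refine ⟨fun r s t ht h0 => ?_, fun i => ?_⟩
    · have hr : r * x ∈ span R {x} := mem_span_singleton.mpr ⟨r, rfl⟩
      have hs : s * y ∈ span R {y} := mem_span_singleton.mpr ⟨s, rfl⟩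
      have h3 : r * x + s * y = 0 := Submodule.disjoint_def.mp h2 _ (add_mem_sup hr hs)
        (by rw [eq_neg_of_add_eq_zero_left h0]; exact neg_mem ht)
      have h4 : r * x = 0 := Submodule.disjoint_def.mp h1 _ hr
        (by rw [eq_neg_of_add_eq_zero_left h3]; exact neg_mem hs)
      rw [h3, zero_add] at h0
      rw [h4, zero_add] at h3
      exact ⟨h4, h3, h0⟩
    · exact mem_span_sup_span_sup_iff

theorem indep_of_disjoint_span {x : R} {N : Ideal R} (h : Disjoint (span R {x}) N) {a n : R}
    (hn : n ∈ N) (h0 : a * x + n = 0) : a * x = 0 ∧ n = 0 := by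
  have h1 : a * x = 0 := Submodule.disjoint_def.mp h _ (mem_span_singleton.mpr ⟨a, rfl⟩)
    (by rw [eq_neg_of_add_eq_zero_left h0]; exact neg_mem hn)
  exact ⟨h1, by rwa [h1, zero_add] at h0⟩

theorem isDirectSumOfSpans_sumElim_pair_iff {x y : R} {I : Ideal R} {Γ : Type*} {w : Γ → R} :
    IsDirectSumOfSpans I (Sum.elim ![x, y] w) ↔
      ∃ S : Ideal R, IsDirectSumOfSpans S w ∧ IsTripleSum x y S I := by
  simp only [isDirectSumOfSpans_sumElim_iff, isTripleSum_iff, isDirectSumOfSpans_pair_iff]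
  constructor
  · rintro ⟨A, B, ⟨h1, rfl⟩, h2, h3, h4⟩
    exact ⟨B, h2, h1, h3, h4⟩
  · rintro ⟨B, h2, h1, h3, h4⟩
    exact ⟨_, B, ⟨h1, rfl⟩, h2, h3, h4⟩

theorem isDirectSumOfSpans_sumElim_single_iff {z : R} {I : Ideal R} {Γ : Type*} {w : Γ → R} :
    IsDirectSumOfSpans I (Sum.elim ![z] w) ↔
      ∃ S : Ideal R, IsDirectSumOfSpans S w ∧ IsTripleSum z 0 S I := by
  simp only [isDirectSumOfSpans_sumElim_iff, isTripleSum_iff, isDirectSumOfSpans_unique_iff]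
  have h0 : span R {(0 : R)} = ⊥ := by simp
  simp only [h0, disjoint_bot_right, sup_bot_eq, true_and]
  constructor
  · rintro ⟨A, B, rfl, h2, h3, h4⟩
    exact ⟨B, h2, h3, h4⟩
  · rintro ⟨B, h2, h3, h4⟩
    exact ⟨_, B, rfl, h2, h3, h4⟩

theorem isPrincipalIdealRing_quotient_ann_of_mem {x p : R} [h : IsPrincipalIdealRing (R ⧸ ann x)]
    (hp : p ∈ span R {x}) : IsPrincipalIdealRing (R ⧸ ann p) := by
  rw [isPrincipalIdealRing_quotient_ann_iff] at *
  exact fun J hJ => h J (hJ.trans (by rwa [span_singleton_le_iff_mem]))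

end

/-! ### Ideals inside a maximal ideal `Rx ⊕ Ry ⊕ S`: from (3) to (4). -/

section Local

variable {R : Type u} [CommRing R] [IsLocalRing R]

theorem mem_maximalIdeal_of_mul_eq_zero {a x : R} (hx : x ≠ 0) (h : a * x = 0) :
    a ∈ maximalIdeal R := by
  rw [mem_maximalIdeal, mem_nonunits_iff]
  exact fun ha => hx (ha.mul_right_eq_zero.mp h)

/-- Let `p` and `q` generate the projections of `I` to `Rx` and `Ry`. Whether `I` contains some `p +
t` with `t ∈ S` decides between two generators and one. -/
theorem exists_isTripleSum_of_le {x y : R} {S : Ideal R} (h : IsTripleSum x y S (maximalIdeal R))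
    (hS : ∀ r ∈ maximalIdeal R, ∀ t ∈ S, r * t = 0) [hx : IsPrincipalIdealRing (R ⧸ ann x)]
    [hy : IsPrincipalIdealRing (R ⧸ ann y)] {I : Ideal R} (hI : I ≤ maximalIdeal R) :
    ∃ x' y', IsTripleSum x' y' (I ⊓ S) I ∧
      (IsPrincipalIdealRing (R ⧸ ann x') ∧ IsPrincipalIdealRing (R ⧸ ann y') ∨ y' = 0) := by
  have hxy := h.mul_eq_zero
  -- An element of `Rx` is the `x`-component of some element of `I` exactly when it lies in `I + Ry
  -- + S`. From here on `p = e * x` and `q = f * y`.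
  obtain ⟨p, hp⟩ := (isPrincipalIdealRing_quotient_ann_iff x).mp hx
    ((I ⊔ span R {y} ⊔ S) ⊓ span R {x}) inf_le_right
  obtain ⟨q, hq⟩ := (isPrincipalIdealRing_quotient_ann_iff y).mp hy
    ((I ⊔ span R {x} ⊔ S) ⊓ span R {y}) inf_le_right
  have hpmem : p ∈ (I ⊔ span R {y} ⊔ S) ⊓ span R {x} := hp ▸ mem_span_singleton_self p
  have hqmem : q ∈ (I ⊔ span R {x} ⊔ S) ⊓ span R {y} := hq ▸ mem_span_singleton_self q
  obtain ⟨e, rfl⟩ := mem_span_singleton.mp hpmem.2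
  obtain ⟨f, rfl⟩ := mem_span_singleton.mp hqmem.2
  have hrep : ∀ i ∈ I, ∀ r s, ∀ t ∈ S, i = r * x + s * y + t →
      (∃ a, r * x = a * (e * x)) ∧ ∃ c, s * y = c * (f * y) := by
    intro i hi r s t ht hit
    constructor
    · have : r * x ∈ span R {e • x} := by
        rw [← hp]
        refine ⟨?_, mem_span_singleton.mpr ⟨r, rfl⟩⟩
        rw [show r * x = i + (-s) * y + (-t) by rw [hit]; ring]
        exact add_mem_sup (add_mem_sup hi (mem_span_singleton.mpr ⟨-s, rfl⟩)) (neg_mem ht)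
      obtain ⟨a, ha⟩ := mem_span_singleton.mp this
      exact ⟨a, ha.symm⟩
    · have : s * y ∈ span R {f • y} := by
        rw [← hq]
        refine ⟨?_, mem_span_singleton.mpr ⟨s, rfl⟩⟩
        rw [show s * y = i + (-r) * x + (-t) by rw [hit]; ring]
        exact add_mem_sup (add_mem_sup hi (mem_span_singleton.mpr ⟨-r, rfl⟩)) (neg_mem ht)
      obtain ⟨a, ha⟩ := mem_span_singleton.mp this
      exact ⟨a, ha.symm⟩
  have hrep' : ∀ i ∈ I, ∃ a c, ∃ t ∈ S, i = a * (e * x) + c * (f * y) + t := by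
    intro i hi
    obtain ⟨r, s, t, ht, hit⟩ := (h.mem_iff i).mp (hI hi)
    obtain ⟨⟨a, ha⟩, c, hc⟩ := hrep i hi r s t ht hit
    exact ⟨a, c, t, ht, by rw [hit, ha, hc]⟩
  obtain ⟨b, t1, ht1, hz⟩ : ∃ b, ∃ t ∈ S, e * x + b * (f * y) + t ∈ I := by
    obtain ⟨u, hu, t, ht, hut⟩ := mem_sup.mp hpmem.1
    obtain ⟨i, hi, v, hv, rfl⟩ := mem_sup.mp hu
    obtain ⟨s, rfl⟩ := mem_span_singleton.mp hv
    simp only [smul_eq_mul] at hut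
    obtain ⟨-, c, hc⟩ := hrep i hi e (-s) (-t) (neg_mem ht) (by rw [← hut]; ring)
    refine ⟨c, -t, neg_mem ht, ?_⟩
    rw [← hc, ← hut]
    convert hi using 1
    ring
  obtain ⟨b', t2, ht2, hz'⟩ : ∃ b, ∃ t ∈ S, f * y + b * (e * x) + t ∈ I := by
    obtain ⟨u, hu, t, ht, hut⟩ := mem_sup.mp hqmem.1
    obtain ⟨i, hi, v, hv, rfl⟩ := mem_sup.mp hu
    obtain ⟨s, rfl⟩ := mem_span_singleton.mp hv
    simp only [smul_eq_mul] at hut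
    obtain ⟨⟨c, hc⟩, -⟩ := hrep i hi (-s) f (-t) (neg_mem ht) (by rw [← hut]; ring)
    refine ⟨c, -t, neg_mem ht, ?_⟩
    rw [← hc, ← hut]
    convert hi using 1
    ring
  -- If `r` has `x`-component `r₁x`, then `rp = r₁x · p = r₁x · (p + bq + t)`, because `x` kills `y`
  -- and `S`. Since `I` contains an element `p + bq + t`, this puts `𝓜p` inside `I`; `hmy` does the
  -- same for `q`.
  have hmx : ∀ r ∈ maximalIdeal R, ∃ r', ∀ b, ∀ t ∈ S,
      r * (e * x) = r' * (e * x + b * (f * y) + t) := by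
    intro r hr
    obtain ⟨r1, r2, t', ht', rfl⟩ := (h.mem_iff r).mp hr
    refine ⟨r1 * x, fun b t ht => ?_⟩
    linear_combination (r2 * e - r1 * b * f) * hxy + e * h.left_mul_eq_zero ht' -
      r1 * h.left_mul_eq_zero ht
  have hmy : ∀ r ∈ maximalIdeal R, ∃ r', ∀ b, ∀ t ∈ S,
      r * (f * y) = r' * (f * y + b * (e * x) + t) := by
    intro r hr
    obtain ⟨r1, r2, t', ht', rfl⟩ := (h.mem_iff r).mp hr
    refine ⟨r2 * y, fun b t ht => ?_⟩
    linear_combination (r1 * f - r2 * b * e) * hxy + f * h.right_mul_eq_zero ht' -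
      r2 * h.right_mul_eq_zero ht
  by_cases hcase : ∃ t ∈ S, e * x + t ∈ I
  -- The correction `s1` is taken to be `0` when `p = 0`. This makes `ann (p + s1) = ann p`: for `p
  -- ≠ 0` the annihilator of `p` lies in `𝓜`, which kills `s1`.
  · obtain ⟨s1, hs1, hps1, hp0⟩ : ∃ t ∈ S, e * x + t ∈ I ∧ (e * x = 0 → t = 0) := by
      by_cases h0 : e * x = 0
      · exact ⟨0, S.zero_mem, by simp [h0], fun _ => rfl⟩
      · obtain ⟨t, ht, ht'⟩ := hcase
        exact ⟨t, ht, ht', fun h => absurd h h0⟩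
    obtain ⟨s2, hs2, hqs2, hq0⟩ : ∃ t ∈ S, f * y + t ∈ I ∧ (f * y = 0 → t = 0) := by
      by_cases h0 : f * y = 0
      · exact ⟨0, S.zero_mem, by simp [h0], fun _ => rfl⟩
      · refine ⟨t2 - b' * s1, sub_mem ht2 (S.mul_mem_left _ hs1), ?_, fun h => absurd h h0⟩
        convert I.sub_mem hz' (I.mul_mem_left b' hps1) using 1
        ring
    have hk1 : ∀ r, r * (e * x) = 0 → r * (e * x + s1) = 0 := by
      intro r hr
      by_cases h0 : e * x = 0
      · rw [hp0 h0, h0]; ring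
      · rw [mul_add, hr, hS r (mem_maximalIdeal_of_mul_eq_zero h0 hr) s1 hs1, add_zero]
    have hk2 : ∀ r, r * (f * y) = 0 → r * (f * y + s2) = 0 := by
      intro r hr
      by_cases h0 : f * y = 0
      · rw [hq0 h0, h0]; ring
      · rw [mul_add, hr, hS r (mem_maximalIdeal_of_mul_eq_zero h0 hr) s2 hs2, add_zero]
    have hind : ∀ r s, ∀ t ∈ S, r * (e * x + s1) + s * (f * y + s2) + t = 0 →
        r * (e * x) = 0 ∧ s * (f * y) = 0 := by
      intro r s t ht h0
      obtain ⟨h1, h2, -⟩ := h.indep (r * e) (s * f) (r * s1 + s * s2 + t)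
        (add_mem (add_mem (S.mul_mem_left _ hs1) (S.mul_mem_left _ hs2)) ht)
        (by rw [← h0]; ring)
      exact ⟨by rw [← h1]; ring, by rw [← h2]; ring⟩
    refine ⟨e * x + s1, f * y + s2, ⟨?_, ?_⟩, Or.inl ⟨?_, ?_⟩⟩
    · intro r s t ht h0
      obtain ⟨h1, h2⟩ := hind r s t ht.2 h0
      have h1 := hk1 r h1
      have h2 := hk2 s h2
      refine ⟨h1, h2, ?_⟩
      rwa [h1, h2, zero_add, zero_add] at h0
    · intro i
      constructor
      · intro hi
        obtain ⟨a, c, t, ht, hit⟩ := hrep' i hi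
        refine ⟨a, c, i - a * (e * x + s1) - c * (f * y + s2), ⟨?_, ?_⟩, by ring⟩
        · exact sub_mem (sub_mem hi (I.mul_mem_left _ hps1)) (I.mul_mem_left _ hqs2)
        · rw [show i - a * (e * x + s1) - c * (f * y + s2) = t - a * s1 - c * s2 by
            rw [hit]; ring]
          exact sub_mem (sub_mem ht (S.mul_mem_left _ hs1)) (S.mul_mem_left _ hs2)
      · rintro ⟨r, s, t, ht, rfl⟩
        exact add_mem (add_mem (I.mul_mem_left _ hps1) (I.mul_mem_left _ hqs2)) ht.1
    · have : ann (e * x + s1) = ann (e * x) := by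
        ext r
        rw [mem_ann, mem_ann]
        exact ⟨fun h0 => (hind r 0 0 S.zero_mem (by rw [h0]; ring)).1, hk1 r⟩
      rw [this]
      exact isPrincipalIdealRing_quotient_ann_of_mem hpmem.2
    · have : ann (f * y + s2) = ann (f * y) := by
        ext r
        rw [mem_ann, mem_ann]
        exact ⟨fun h0 => (hind 0 r 0 S.zero_mem (by rw [h0]; ring)).2, hk2 r⟩
      rw [this]
      exact isPrincipalIdealRing_quotient_ann_of_mem hqmem.2
  · have hp0 : e * x ≠ 0 := fun h0 => hcase ⟨0, S.zero_mem, by simp [h0]⟩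
    -- If `b` were in `𝓜`, then `bq ∈ I`, and subtracting it from `p + bq + t1` would give the
    -- excluded case.
    have hb : IsUnit b := by
      by_contra hb
      obtain ⟨r', hr'⟩ := hmy b hb
      have hbI : b * (f * y) ∈ I := by
        rw [hr' b' t2 ht2]
        exact I.mul_mem_left _ hz'
      refine hcase ⟨t1, ht1, ?_⟩
      convert sub_mem hz hbI using 1
      ring
    refine ⟨e * x + b * (f * y) + t1, 0, ⟨?_, ?_⟩, Or.inr rfl⟩
    · intro r s t ht h0
      rw [mul_zero, add_zero] at h0
      obtain ⟨h1, h2, -⟩ := h.indep (r * e) (r * b * f) (r * t1 + t)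
        (add_mem (S.mul_mem_left _ ht1) ht.2) (by rw [← h0]; ring)
      have h3 := hS r (mem_maximalIdeal_of_mul_eq_zero hp0 (by rw [← h1]; ring)) t1 ht1
      have h4 : r * (e * x + b * (f * y) + t1) = 0 := by linear_combination h1 + h2 + h3
      exact ⟨h4, mul_zero _, by rwa [h4, zero_add] at h0⟩
    · intro i
      constructor
      · intro hi
        obtain ⟨a, c, t, ht, hit⟩ := hrep' i hi
        -- Subtracting `a (p + bq + t1)` from `i` leaves `(c - ab) q` plus an element of `S`. A unit
        -- coefficient would put some `q + t` in `I`, hence some `p + t` as well.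
        have hcab : c - a * b ∈ maximalIdeal R := by
          rw [mem_maximalIdeal, mem_nonunits_iff]
          rintro hunit
          obtain ⟨v, hv⟩ := hunit.exists_left_inv
          refine hcase ⟨t1 - b * (v * (t - a * t1)), sub_mem ht1 (S.mul_mem_left _
            (S.mul_mem_left _ (sub_mem ht (S.mul_mem_left _ ht1)))), ?_⟩
          have h1 := I.mul_mem_left (b * v) (sub_mem hi (I.mul_mem_left a hz))
          convert sub_mem hz h1 using 1
          rw [hit]
          linear_combination (b * f * y) * hv
        obtain ⟨r', hr'⟩ := hmy _ hcab
        obtain ⟨v, hv⟩ := hb.exists_left_inv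
        have h1 : (c - a * b) * (f * y) = r' * v * (e * x + b * (f * y) + t1) := by
          -- With `vb = 1`, the element `q + vp + v t1` is `v (p + bq + t1)`, so `(c - ab) q` is a
          -- multiple of the single generator.
          rw [hr' (v * 1) (v * t1) (S.mul_mem_left _ ht1)]
          linear_combination (-(r' * f * y)) * hv
        refine ⟨a + r' * v, 0, i - (a + r' * v) * (e * x + b * (f * y) + t1), ⟨?_, ?_⟩, by ring⟩
        · exact sub_mem hi (I.mul_mem_left _ hz)
        · rw [show i - (a + r' * v) * (e * x + b * (f * y) + t1) = t - a * t1 by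
            rw [hit]; linear_combination h1]
          exact sub_mem ht (S.mul_mem_left _ ht1)
      · rintro ⟨r, s, t, ht, rfl⟩
        rw [mul_zero, add_zero]
        exact add_mem (I.mul_mem_left _ hz) ht.1

/-- If `z ∉ J`, then `J ⊆ 𝓜z`. Multiplication by `𝓜` removes the `S`-component of `z`, so `J ∩ S =
0` and the decomposition of `J` has no simple part left over. -/
theorem exists_pair_of_le_span {x y : R} {S : Ideal R}
    (h : IsTripleSum x y S (maximalIdeal R))
    (hS : ∀ r ∈ maximalIdeal R, ∀ t ∈ S, r * t = 0) [IsPrincipalIdealRing (R ⧸ ann x)]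
    [IsPrincipalIdealRing (R ⧸ ann y)] {z : R} (hz : z ∈ maximalIdeal R) {J : Ideal R}
    (hJ : J ≤ span R {z}) :
    ∃ a b, Disjoint (span R {a}) (span R {b}) ∧ span R {a} ⊔ span R {b} = J := by
  by_cases hzJ : z ∈ J
  · refine ⟨z, 0, by simp, ?_⟩
    rw [span_zero_singleton, sup_bot_eq]
    exact le_antisymm (by rwa [span_singleton_le_iff_mem]) hJ
  · have hJS : J ⊓ S = ⊥ := by
      rw [eq_bot_iff]
      rintro j ⟨hj, hjS⟩
      obtain ⟨r, rfl⟩ := mem_span_singleton.mp (hJ hj)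
      have hr : r ∈ maximalIdeal R := by
        rw [mem_maximalIdeal, mem_nonunits_iff]
        exact fun hr => hzJ ((J.smul_mem_iff_of_isUnit hr).mp hj)
      obtain ⟨a, b, t, ht, rfl⟩ := (h.mem_iff z).mp hz
      simp only [smul_eq_mul] at *
      have h1 := hS r hr t ht
      have h2 := (h.indep (r * a) (r * b) _ (neg_mem hjS)
        (by linear_combination -h1)).2.2
      simpa using h2
    obtain ⟨a, b, hab, -⟩ :=
      exists_isTripleSum_of_le h hS (hJ.trans (by rwa [span_singleton_le_iff_mem]))
    rw [hJS, isTripleSum_iff] at hab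
    exact ⟨a, b, hab.1, by simpa using hab.2.2⟩

theorem properIdealsHaveForms_of_hasFormTwo {Λ : Type u} (h : HasFormTwo (maximalIdeal R) Λ) :
    ProperIdealsHaveForms R Λ := by
  obtain ⟨x, y, w, hw, hsimple, hx, hy⟩ := h
  obtain ⟨S, hS, hT⟩ := isDirectSumOfSpans_sumElim_pair_iff.mp hw
  have hmw : ∀ r ∈ maximalIdeal R, ∀ l, r * w l = 0 := fun r hr l =>
    (isSimpleModule_span_singleton_iff.mp (hsimple l)).2 r hr
  have hmS : ∀ r ∈ maximalIdeal R, ∀ t ∈ S, r * t = 0 := by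
    intro r hr t ht
    have : S ≤ LinearMap.ker (LinearMap.mulLeft R r) := by
      rw [← hS.span_range, span_le]
      rintro _ ⟨l, rfl⟩
      exact hmw r hr l
    exact this ht
  intro I hI
  have hIm := le_maximalIdeal hI
  obtain ⟨Γ, w', hΓ, hw', hs'⟩ := exists_isDirectSumOfSpans_simple (S := I ⊓ S) w hmw
    (hS.span_range ▸ inf_le_right)
  refine ⟨Γ, hΓ, ?_⟩
  obtain ⟨x', y', hT', hxy | rfl⟩ := exists_isTripleSum_of_le hT hmS hIm
  · exact Or.inl ⟨x', y', w', isDirectSumOfSpans_sumElim_pair_iff.mpr ⟨_, hw', hT'⟩, hs', hxy⟩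
  · refine Or.inr ⟨x', w', isDirectSumOfSpans_sumElim_single_iff.mpr ⟨_, hw', hT'⟩, hs', ?_⟩
    exact forall_isDirectSumOfTwoPrincipal_quotient_ann x' fun J hJ =>
      exists_pair_of_le_span hT hmS (hIm hT'.left_mem) hJ

end Local

/-! ### The structure of the maximal ideal: from cyclic summands to (3). -/

section Local

variable {R : Type u} [CommRing R] [IsLocalRing R]

/-- A form of Nakayama's lemma without finite generation. If `P = Rc ⊕ N` and `P = 𝓜P`, then `c ∈ 𝓜c
+ N`, which forces `c ∈ N` and so `c = 0`. -/
theorem HasCyclicSummands.eq_bot_of_le_smul {P : Ideal R} (h : HasCyclicSummands P)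
    (hP : P ≤ maximalIdeal R • P) : P = ⊥ := by
  rw [eq_bot_iff]
  intro x hx
  by_contra hx0
  obtain ⟨c, N, hd, rfl, hxN⟩ := h x hx hx0
  have hc := hP (mem_sup_left (mem_span_singleton_self c))
  rw [Submodule.smul_sup] at hc
  obtain ⟨u, hu, v, hv, huv⟩ := mem_sup.mp hc
  obtain ⟨r, hr, rfl⟩ := mem_smul_span_singleton.mp hu
  have hvN : v ∈ N := smul_le_right hv
  have hunit : IsUnit (1 - r) :=
    (isUnit_or_isUnit_one_sub_self r).resolve_left ((mem_maximalIdeal r).mp hr)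
  have hcN : c ∈ N := by
    rw [← N.smul_mem_iff_of_isUnit hunit]
    convert hvN using 1
    rw [sub_smul, one_smul, sub_eq_iff_eq_add', huv]
  obtain rfl := Submodule.disjoint_def.mp hd c (mem_span_singleton_self c) hcN
  simp at hx
  exact hxN hx

/-- Modulo `𝓜`, the element `α(x + y) + β(y + z)` has coordinates `(α, α + β, β)` along `x, y, z`.
If one of `α, β` is nonzero, at least two coordinates are nonzero. Complementary summands must have
coordinatewise product zero, so one of them has all its coordinates zero. -/
theorem not_hasCyclicSummands_span_pair {x y z : R} (hxy : x * y = 0) (hyz : y * z = 0)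
    (hxz : x * z = 0)
    (hind : ∀ a b c, a * x + b * y + c * z = 0 → a * x = 0 ∧ b * y = 0 ∧ c * z = 0)
    (hx : x * x ≠ 0) (hy : y * y ≠ 0) (hz : z * z ≠ 0) :
    ¬ HasCyclicSummands (Ideal.span {x + y, y + z}) := by
  intro h
  have hx0 : x ≠ 0 := fun h => hx (by simp [h])
  have hy0 : y ≠ 0 := fun h => hy (by simp [h])
  have hz0 : z ≠ 0 := fun h => hz (by simp [h])
  have h1I : x + y ∈ Ideal.span {x + y, y + z} := Ideal.subset_span (by simp)
  have h2I : y + z ∈ Ideal.span {x + y, y + z} := Ideal.subset_span (by simp)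
  obtain ⟨c, N, hd, hN, hxN⟩ := h (x + y) h1I fun h0 => hx (by linear_combination x * h0 - hxy)
  have hcI : c ∈ Ideal.span {x + y, y + z} := hN ▸ mem_sup_left (mem_span_singleton_self c)
  have hNI : N ≤ Ideal.span {x + y, y + z} := hN ▸ le_sup_right
  have hd' : ∀ p r s n, n ∈ N → p = r * c → p = s * n → p = 0 := fun p r s n hn h1 h2 =>
    Submodule.disjoint_def.mp hd p (mem_span_singleton.mpr ⟨r, h1.symm⟩)
      (h2 ▸ N.mul_mem_left s hn)
  have hres : ∀ a : R, a ∈ maximalIdeal R → residue R a = 0 :=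
    fun a ha => (residue_eq_zero_iff a).mpr ha
  obtain ⟨α, β, rfl⟩ := Ideal.mem_span_pair.mp hcI
  -- With `c` the generator and `n ∈ N`, `γx · c = αγx² = αx · n` lies in `Rc ∩ N = 0`. Since `x² ≠
  -- 0`, `αγ ∈ 𝓜`; multiples of `y` and `z` give the other two products.
  have hN0 : ∀ γ δ, γ * (x + y) + δ * (y + z) ∈ N → residue R α * residue R γ = 0 ∧
      (residue R α + residue R β) * (residue R γ + residue R δ) = 0 ∧
      residue R β * residue R δ = 0 := by
    intro γ δ hn
    simp only [← map_mul, ← map_add]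
    refine ⟨hres _ (mem_maximalIdeal_of_mul_eq_zero hx ?_),
      hres _ (mem_maximalIdeal_of_mul_eq_zero hy ?_),
      hres _ (mem_maximalIdeal_of_mul_eq_zero hz ?_)⟩
    · refine hd' _ (γ * x) (α * x) _ hn ?_ ?_
      · linear_combination -(γ * α + γ * β) * hxy - γ * β * hxz
      · linear_combination -(α * γ + α * δ) * hxy - α * δ * hxz
    · refine hd' _ ((γ + δ) * y) ((α + β) * y) _ hn ?_ ?_
      · linear_combination -((γ + δ) * α) * hxy - (γ + δ) * β * hyz
      · linear_combination -((α + β) * γ) * hxy - (α + β) * δ * hyz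
    · refine hd' _ (δ * z) (β * z) _ hn ?_ ?_
      · linear_combination -(δ * α) * hxz - (δ * α + δ * β) * hyz
      · linear_combination -(β * γ) * hxz - (β * γ + β * δ) * hyz
  have hdec : ∀ i ∈ Ideal.span {x + y, y + z}, ∃ r, ∃ n ∈ N,
      i = r * (α * (x + y) + β * (y + z)) + n := by
    intro i hi
    rw [← hN] at hi
    obtain ⟨u, hu, n, hn, rfl⟩ := mem_sup.mp hi
    obtain ⟨r, rfl⟩ := mem_span_singleton.mp hu
    exact ⟨r, n, hn, rfl⟩
  obtain ⟨r, n, hn, hrn⟩ := hdec _ h1I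
  obtain ⟨s, n', hn', hsn⟩ := hdec _ h2I
  obtain ⟨γ, δ, rfl⟩ := Ideal.mem_span_pair.mp (hNI hn)
  obtain ⟨γ', δ', rfl⟩ := Ideal.mem_span_pair.mp (hNI hn')
  have hcoord : ∀ a b, a * (x + y) + b * (y + z) = 0 → residue R a = 0 ∧ residue R b = 0 := by
    intro a b h0
    obtain ⟨h1, -, h3⟩ := hind a (a + b) b (by rw [← h0]; ring)
    exact ⟨hres _ (mem_maximalIdeal_of_mul_eq_zero hx0 h1),
      hres _ (mem_maximalIdeal_of_mul_eq_zero hz0 h3)⟩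
  obtain ⟨e1, e2⟩ := hcoord (1 - γ - r * α) (-δ - r * β) (by linear_combination hrn)
  obtain ⟨e3, e4⟩ := hcoord (-γ' - s * α) (1 - δ' - s * β) (by linear_combination hsn)
  obtain ⟨f1, f2, f3⟩ := hN0 γ δ hn
  obtain ⟨g1, g2, g3⟩ := hN0 γ' δ' hn'
  simp only [map_sub, map_mul, map_neg, map_one] at e1 e2 e3 e4
  by_cases hαβ : residue R α = 0 ∧ residue R β = 0
  -- Here `c` has coefficients in `𝓜`. Expanding both generators along `Rc ⊕ N` gives `(1 - αr - βs)
  -- c ∈ N`, so `c = 0` and `x + y ∈ N`.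
  · have hunit : IsUnit (1 - α * r - β * s) := by
      by_contra hu
      have := hres _ hu
      simp [hαβ.1, hαβ.2] at this
    have hcN : α * (x + y) + β * (y + z) ∈ N := by
      rw [← N.smul_mem_iff_of_isUnit hunit]
      convert add_mem (N.mul_mem_left α hn) (N.mul_mem_left β hn') using 1
      rw [smul_eq_mul]
      linear_combination α * hrn + β * hsn
    have hc0 := hd' _ 1 1 _ hcN (one_mul _).symm (one_mul _).symm
    refine hxN ?_
    rw [hrn, hc0, mul_zero, zero_add]
    exact hn
  -- Here the coefficients found for elements of `N` vanish modulo `𝓜`. Both generators would be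
  -- multiples of `c` modulo `𝓜`, making the 2 × 2 identity matrix of rank at most one.
  · have key : ∀ a b c d : ResidueField R, ¬ (a = 0 ∧ b = 0) → a * c = 0 →
        (a + b) * (c + d) = 0 → b * d = 0 → c = 0 ∧ d = 0 := by
      intro a b c d hab h1 h2 h3
      rcases mul_eq_zero.mp h1 with rfl | rfl
      · have hb : b ≠ 0 := fun hb => hab ⟨rfl, hb⟩
        have hd := (mul_eq_zero.mp h3).resolve_left hb
        subst hd
        simp [hb] at h2
        exact ⟨h2, rfl⟩
      · rcases mul_eq_zero.mp h3 with rfl | rfl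
        · have ha : a ≠ 0 := fun ha => hab ⟨ha, rfl⟩
          simp [ha] at h2
          exact ⟨rfl, h2⟩
        · exact ⟨rfl, rfl⟩
    obtain ⟨k1, k2⟩ := key _ _ _ _ hαβ f1 f2 f3
    obtain ⟨k3, k4⟩ := key _ _ _ _ hαβ g1 g2 g3
    rw [k1] at e1
    rw [k2] at e2
    rw [k3] at e3
    rw [k4] at e4
    have : (1 : ResidueField R) = 0 := by
      linear_combination (residue R s * residue R β) * e1 - (residue R s * residue R α) * e2 + e4
    exact one_ne_zero this

/-- Take a summand `Rc` in which a nonzero `r * n` has a nonzero component. That component is a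
multiple of `r * c`. -/
theorem HasCyclicSummands.exists_summand_of_not_semisimple {N : Ideal R}
    (h : HasCyclicSummands N) (hN : ¬ ∀ r ∈ maximalIdeal R, ∀ n ∈ N, r * n = 0) :
    ∃ (c : R) (N' : Ideal R), Disjoint (span R {c}) N' ∧ span R {c} ⊔ N' = N ∧
      ∃ r ∈ maximalIdeal R, r * c ≠ 0 := by
  push Not at hN
  obtain ⟨r, hr, n, hn, hrn⟩ := hN
  obtain ⟨c, N', hd, rfl, hx⟩ := h _ (N.mul_mem_left r hn) hrn
  refine ⟨c, N', hd, rfl, r, hr, fun h0 => hx ?_⟩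
  obtain ⟨u, hu, n', hn', rfl⟩ := mem_sup.mp hn
  obtain ⟨a, rfl⟩ := mem_span_singleton.mp hu
  rw [smul_eq_mul, show r * (a * c + n') = a * (r * c) + r * n' by ring, h0, mul_zero, zero_add]
  exact N'.mul_mem_left r hn'

/-- Cyclic summands not killed by `𝓜` are split off until the complement is killed by `𝓜`. A third
one is impossible by `not_hasCyclicSummands_span_pair`. -/
theorem exists_isTripleSum_maximalIdeal (h : ∀ N : Ideal R, HasCyclicSummands N) :
    ∃ x y S, IsTripleSum x y S (maximalIdeal R) ∧
      ∀ r ∈ maximalIdeal R, ∀ t ∈ S, r * t = 0 := by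
  by_cases h0 : ∀ r ∈ maximalIdeal R, ∀ n ∈ maximalIdeal R, r * n = 0
  · exact ⟨0, 0, _, isTripleSum_iff.mpr (by simp), h0⟩
  obtain ⟨x, N₁, hd₁, hm, r₁, hr₁, hx⟩ := (h _).exists_summand_of_not_semisimple h0
  by_cases h1 : ∀ r ∈ maximalIdeal R, ∀ n ∈ N₁, r * n = 0
  · exact ⟨x, 0, N₁, isTripleSum_iff.mpr (by simp [hd₁, hm]), h1⟩
  obtain ⟨y, N₂, hd₂, rfl, r₂, hr₂, hy⟩ := (h _).exists_summand_of_not_semisimple h1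
  have hxy : Disjoint (span R {x}) (span R {y}) := hd₁.mono_right le_sup_left
  by_cases h2 : ∀ r ∈ maximalIdeal R, ∀ n ∈ N₂, r * n = 0
  · refine ⟨x, y, N₂, isTripleSum_iff.mpr ⟨hxy, ?_, by rwa [sup_assoc]⟩, h2⟩
    exact Disjoint.disjoint_sup_left_of_disjoint_sup_right hd₂ hd₁
  obtain ⟨z, N₃, hd₃, rfl, r₃, hr₃, hz⟩ := (h _).exists_summand_of_not_semisimple h2
  exfalso
  have hind : ∀ a b c, ∀ n ∈ N₃, a * x + b * y + c * z + n = 0 →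
      a * x = 0 ∧ b * y = 0 ∧ c * z = 0 := by
    intro a b c n hn h0
    have m3 : c * z + n ∈ span R {z} ⊔ N₃ := add_mem_sup (mem_span_singleton.mpr ⟨c, rfl⟩) hn
    have m2 : b * y + (c * z + n) ∈ span R {y} ⊔ (span R {z} ⊔ N₃) :=
      add_mem_sup (mem_span_singleton.mpr ⟨b, rfl⟩) m3
    obtain ⟨k1, k2⟩ := indep_of_disjoint_span (a := a) hd₁ m2 (by rw [← h0]; ring)
    obtain ⟨k3, k4⟩ := indep_of_disjoint_span hd₂ m3 k2
    exact ⟨k1, k3, (indep_of_disjoint_span hd₃ hn k4).1⟩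
  have hrep : ∀ r ∈ maximalIdeal R, ∃ a b c, ∃ n ∈ N₃, r = a * x + b * y + c * z + n := by
    intro r hr
    rw [← hm] at hr
    obtain ⟨u, hu, v, hv, rfl⟩ := mem_sup.mp hr
    obtain ⟨v, hv', w, hw, rfl⟩ := mem_sup.mp hv
    obtain ⟨w, hw', n, hn, rfl⟩ := mem_sup.mp hw
    obtain ⟨a, rfl⟩ := mem_span_singleton.mp hu
    obtain ⟨b, rfl⟩ := mem_span_singleton.mp hv'
    obtain ⟨c, rfl⟩ := mem_span_singleton.mp hw'
    exact ⟨a, b, c, n, hn, by simp only [smul_eq_mul]; ring⟩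
  have z3 := N₃.zero_mem
  have pxy : x * y = 0 := (hind (-y) x 0 0 z3 (by ring)).2.1
  have pxz : x * z = 0 := (hind (-z) 0 x 0 z3 (by ring)).2.2
  have pyz : y * z = 0 := (hind 0 (-z) y 0 z3 (by ring)).2.2
  have pn : ∀ n ∈ N₃, n * x = 0 ∧ n * y = 0 ∧ n * z = 0 := fun n hn =>
    ⟨(hind n 0 0 (-x * n) (N₃.mul_mem_left _ hn) (by ring)).1,
      (hind 0 n 0 (-y * n) (N₃.mul_mem_left _ hn) (by ring)).2.1,
      (hind 0 0 n (-z * n) (N₃.mul_mem_left _ hn) (by ring)).2.2⟩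
  -- The squares are nonzero: only the `x`-component of `r₁ ∈ 𝓜` acts on `x`, so `x² = 0` would give
  -- `r₁x = 0`. The same holds for `y` and `z`.
  refine not_hasCyclicSummands_span_pair pxy pyz pxz
    (fun a b c h0 => hind a b c 0 z3 (by rw [h0, add_zero])) ?_ ?_ ?_ (h _)
  · intro hxx
    obtain ⟨a, b, c, n, hn, rfl⟩ := hrep r₁ hr₁
    exact hx (by linear_combination a * hxx + b * pxy + c * pxz + (pn n hn).1)
  · intro hyy
    obtain ⟨a, b, c, n, hn, rfl⟩ := hrep r₂ hr₂
    exact hy (by linear_combination a * pxy + b * hyy + c * pyz + (pn n hn).2.1)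
  · intro hzz
    obtain ⟨a, b, c, n, hn, rfl⟩ := hrep r₃ hr₃
    exact hz (by linear_combination a * pxz + b * pyz + c * hzz + (pn n hn).2.2)

/-- At the last power with `p = r x ^ (k + 1)`, the factor `r` is a unit, since `r ∈ 𝓜` would let
`rx ∈ Rx²` supply one more power. -/
theorem exists_eq_unit_mul_pow_or_forall_mem {x : R}
    (hmx : ∀ r ∈ maximalIdeal R, ∃ a, r * x = a * (x * x)) {p : R} (hp : p ∈ span R {x}) :
    (∃ u n, IsUnit u ∧ p = u * x ^ (n + 1)) ∨ ∀ n, p ∈ span R {x ^ n} := by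
  classical
  rw [or_iff_not_imp_right]
  intro hn
  push Not at hn
  obtain ⟨k, hk⟩ : ∃ k, Nat.find hn = k + 2 := by
    have h0 : Nat.find hn ≠ 0 := fun h0 => by
      have := Nat.find_spec hn
      rw [h0, pow_zero] at this
      exact this (mem_span_singleton.mpr ⟨p, by simp⟩)
    have h1 : Nat.find hn ≠ 1 := fun h1 => by
      have := Nat.find_spec hn
      rw [h1, pow_one] at this
      exact this hp
    exact ⟨Nat.find hn - 2, by omega⟩
  have h1 := Nat.find_spec hn
  have h2 := Nat.find_min hn (m := k + 1) (by omega)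
  rw [hk] at h1
  rw [not_not] at h2
  obtain ⟨r, rfl⟩ := mem_span_singleton.mp h2
  refine ⟨r, k, ?_, rfl⟩
  by_contra hr
  obtain ⟨a, ha⟩ := hmx r hr
  refine h1 (mem_span_singleton.mpr ⟨a, ?_⟩)
  simp only [smul_eq_mul]
  linear_combination (-x ^ k) * ha

/-- The intersection `P` of the `Rxⁿ` satisfies `P = 𝓜P`, so it vanishes. Each nonzero element of
`Rx` is then a unit times a power of `x`, and the least power in an ideal generates it. -/
theorem isPrincipalIdealRing_quotient_ann {x : R} (hxm : x ∈ maximalIdeal R)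
    (hmx : ∀ r ∈ maximalIdeal R, ∃ a, r * x = a * (x * x))
    (h : ∀ P : Ideal R, P ≤ maximalIdeal R • P → P = ⊥) :
    IsPrincipalIdealRing (R ⧸ ann x) := by
  classical
  have hP : (⨅ n, span R {x ^ n}) ⊓ span R {x} = ⊥ := by
    refine h _ fun p hp => ?_
    have hpn : ∀ n, p ∈ span R {x ^ n} := (mem_iInf _).mp hp.1
    -- Write `p = x · (rx)`. Either `rx` lies in `P` again, giving `p ∈ 𝓜P`, or `rx = u x ^ (k + 1)`
    -- with `u` a unit. In the second case `p ∈ R x ^ (k + 3)` forces `x ^ (k + 2) = 0`, hence `p =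
    -- 0`.
    obtain ⟨r, hr⟩ := mem_span_singleton.mp (hpn 2)
    have hq : r * x ∈ span R {x} := mem_span_singleton.mpr ⟨r, rfl⟩
    rcases exists_eq_unit_mul_pow_or_forall_mem hmx hq with ⟨u, k, hu, huk⟩ | hq'
    · obtain ⟨s, hs⟩ := mem_span_singleton.mp (hpn (k + 3))
      simp only [smul_eq_mul] at hr hs
      have hunit : IsUnit (u - s * x) := by
        by_contra hc
        refine (mem_maximalIdeal u).mp ?_ hu
        convert add_mem ((mem_maximalIdeal _).mpr hc)
          ((maximalIdeal R).mul_mem_left s hxm) using 1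
        ring
      have h0 : x ^ (k + 2) = 0 := hunit.mul_right_eq_zero.mp (by
        linear_combination hr - hs - x * huk)
      rw [← hs, show x ^ (k + 3) = x ^ (k + 2) * x by ring, h0, zero_mul, mul_zero]
      exact zero_mem _
    · rw [show p = x • (r * x) by rw [← hr]; simp only [smul_eq_mul]; ring]
      exact smul_mem_smul hxm ⟨(mem_iInf _).mpr hq', hq⟩
  rw [isPrincipalIdealRing_quotient_ann_iff]
  intro J hJ
  have hJ' : ∀ p ∈ J, p = 0 ∨ ∃ u n, IsUnit u ∧ p = u * x ^ (n + 1) := by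
    intro p hp
    rcases exists_eq_unit_mul_pow_or_forall_mem hmx (hJ hp) with h | h
    · exact Or.inr h
    · left
      have : p ∈ (⨅ n, span R {x ^ n}) ⊓ span R {x} := ⟨(mem_iInf _).mpr h, hJ hp⟩
      rwa [hP] at this
  have hpow : ∀ u n, IsUnit u → u * x ^ (n + 1) ∈ J → x ^ (n + 1) ∈ J := fun u n hu hJ =>
    (J.smul_mem_iff_of_isUnit hu).mp hJ
  by_cases hex : ∃ n, x ^ (n + 1) ∈ J
  · refine ⟨x ^ (Nat.find hex + 1), le_antisymm (fun p hp => ?_) ?_⟩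
    · rcases hJ' p hp with rfl | ⟨u, n, hu, rfl⟩
      · exact zero_mem _
      · have hle := Nat.find_min' hex (hpow u n hu hp)
        refine mem_span_singleton.mpr ⟨u * x ^ (n - Nat.find hex), ?_⟩
        rw [smul_eq_mul, mul_assoc, ← pow_add]
        congr 2
        omega
    · rw [span_singleton_le_iff_mem]
      exact Nat.find_spec hex
  · refine ⟨0, ?_⟩
    rw [span_zero_singleton, eq_bot_iff]
    intro p hp
    rcases hJ' p hp with rfl | ⟨u, n, hu, rfl⟩
    · exact zero_mem _
    · exact absurd ⟨n, hpow u n hu hp⟩ hex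

theorem IsTripleSum.isPrincipalIdealRing_left {x y : R} {S : Ideal R}
    (h : IsTripleSum x y S (maximalIdeal R)) (hN : ∀ N : Ideal R, HasCyclicSummands N) :
    IsPrincipalIdealRing (R ⧸ ann x) := by
  refine isPrincipalIdealRing_quotient_ann h.left_mem (fun r hr => ?_)
    fun P => (hN P).eq_bot_of_le_smul
  obtain ⟨a, b, t, ht, rfl⟩ := (h.mem_iff r).mp hr
  exact ⟨a, by linear_combination b * h.mul_eq_zero + h.left_mul_eq_zero ht⟩

theorem exists_hasFormTwo_of_hasCyclicSummands (h : ∀ N : Ideal R, HasCyclicSummands N) :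
    ∃ Λ : Type u, HasFormTwo (maximalIdeal R) Λ := by
  obtain ⟨x, y, S, hT, hS⟩ := exists_isTripleSum_maximalIdeal h
  obtain ⟨Γ, w, -, hw, hs⟩ := exists_isDirectSumOfSpans_simple (S := S) (Subtype.val : S → R)
    (fun r hr l => hS r hr l l.2) (by simp)
  exact ⟨Γ, x, y, w, isDirectSumOfSpans_sumElim_pair_iff.mpr ⟨S, hw, hT⟩, hs,
    hT.isPrincipalIdealRing_left h, hT.symm.isPrincipalIdealRing_left h⟩

/-- For the maximal ideal itself, form (ii) is form (i) with `y = 0`: the principal ideal property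
holds for any decomposition `Rx ⊕ Ry ⊕ S` of `𝓜`. The simple summands are unchanged, so the
cardinality is kept. -/
theorem HasFormOne.hasFormTwo {Γ : Type u} (hform : HasFormOne (maximalIdeal R) Γ)
    (h : ∀ N : Ideal R, HasCyclicSummands N) : HasFormTwo (maximalIdeal R) Γ := by
  obtain ⟨z, w, hw, hs, -⟩ := hform
  obtain ⟨S, hw, hT⟩ := isDirectSumOfSpans_sumElim_single_iff.mp hw
  exact ⟨z, 0, w, isDirectSumOfSpans_sumElim_pair_iff.mpr ⟨S, hw, hT⟩, hs,
    hT.isPrincipalIdealRing_left h, hT.symm.isPrincipalIdealRing_left h⟩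

end Local

/-! ### Consequences of (4): at most two nonsimple summands, the return to (3), and the cardinal
bound. -/

section Forms

variable {R : Type u} [CommRing R]

theorem encard_nonsimple_sumElim_le {n : ℕ} (hn : n ≤ 2) {Γ : Type u} (a : Fin n → R) (w : Γ → R)
    (hs : ∀ γ, IsSimpleModule R (span R {w γ})) :
    {i | ¬ IsSimpleModule R (span R {(Sum.elim a w : Fin n ⊕ Γ → R) i})}.encard ≤ 2 := by
  have hsub : {i | ¬ IsSimpleModule R (span R {(Sum.elim a w : Fin n ⊕ Γ → R) i})} ⊆
      Set.range Sum.inl := by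
    rintro (i | γ) hi
    · exact ⟨i, rfl⟩
    · exact absurd (hs γ) hi
  refine (Set.encard_le_encard hsub).trans ?_
  rw [← Set.image_univ, Sum.inl_injective.encard_image, Set.encard_univ]
  simp only [ENat.card_eq_coe_fintype_card, Fintype.card_fin]
  exact_mod_cast hn

theorem isDirectSumOfSpans_top_one :
    IsDirectSumOfSpans (⊤ : Ideal R) (fun _ : PUnit.{u + 1} => (1 : R)) :=
  isDirectSumOfSpans_unique_iff.mpr Ideal.span_singleton_one

theorem ProperIdealsHaveForms.isDirectSumOfCyclicsTwoNonsimple {Λ : Type u}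
    (h : ProperIdealsHaveForms R Λ) (I : Ideal R) : IsDirectSumOfCyclicsTwoNonsimple I := by
  by_cases hI : I = ⊤
  · subst hI
    refine ⟨PUnit, fun _ => 1, isDirectSumOfSpans_top_one, ?_⟩
    refine (Set.encard_le_encard (Set.subset_univ _)).trans ?_
    rw [Set.encard_univ]
    simp
  · obtain ⟨Γ, -, ⟨x, y, w, hw, hs, -⟩ | ⟨z, w, hw, hs, -⟩⟩ := h I hI
    · exact ⟨_, _, hw, encard_nonsimple_sumElim_le le_rfl _ w hs⟩
    · exact ⟨_, _, hw, encard_nonsimple_sumElim_le one_le_two _ w hs⟩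

theorem IsDirectSumOfCyclicsTwoNonsimple.isDirectSumOfCyclics {I : Ideal R}
    (h : IsDirectSumOfCyclicsTwoNonsimple I) : IsDirectSumOfCyclics I := by
  obtain ⟨ι, a, ha, -⟩ := h
  exact ⟨ι, a, ha⟩

variable [IsLocalRing R]

theorem ProperIdealsHaveForms.hasCyclicSummands {Λ : Type u}
    (h : ProperIdealsHaveForms R Λ) (N : Ideal R) : HasCyclicSummands N :=
  hasCyclicSummands_of_isSummand
    (h.isDirectSumOfCyclicsTwoNonsimple N).isDirectSumOfCyclics.isSummand

theorem ProperIdealsHaveForms.exists_hasFormTwo {Λ : Type u} (h : ProperIdealsHaveForms R Λ) :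
    ∃ Γ : Type u, Cardinal.mk Γ ≤ Cardinal.mk Λ ∧ HasFormTwo (maximalIdeal R) Γ := by
  obtain ⟨Γ, hΓ, hform | hform⟩ := h (maximalIdeal R) (maximalIdeal.isMaximal R).ne_top
  · exact ⟨Γ, hΓ, hform⟩
  · exact ⟨Γ, hΓ, hform.hasFormTwo h.hasCyclicSummands⟩

theorem ProperIdealsHaveForms.mk_le {Λ : Type u} (h : ProperIdealsHaveForms R Λ) {I : Ideal R}
    {κ : Type u} {a : κ → R} (h0 : ∀ k, a k ≠ 0) (ha : IsDirectSumOfSpans I a) :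
    Cardinal.mk κ ≤ Cardinal.mk Λ + 2 := by
  by_cases hI : I = ⊤
  · subst hI
    refine (mk_le_of_isDirectSumOfSpans ha h0 isDirectSumOfSpans_top_one.span_range).trans ?_
    rw [Cardinal.mk_punit]
    exact one_le_two.trans (self_le_add_left _ _)
  · obtain ⟨Γ, hΓ, ⟨x, y, w, hw, -⟩ | ⟨z, w, hw, -⟩⟩ := h I hI
    · refine (mk_le_of_isDirectSumOfSpans ha h0 hw.span_range).trans ?_
      rw [Cardinal.mk_sum, add_comm]
      simpa using add_le_add_left hΓ 2
    · refine (mk_le_of_isDirectSumOfSpans ha h0 hw.span_range).trans ?_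
      rw [Cardinal.mk_sum, add_comm]
      simpa using add_le_add hΓ one_le_two

end Forms

end CyclicIdeals

theorem theorem3p7 (R : Type u) [CommRing R] [IsLocalRing R] :
    List.TFAE
      [∀ I : Ideal R, CyclicIdeals.IsDirectSumOfCyclics I,
       ∀ I : Ideal R, CyclicIdeals.IsDirectSumOfCyclicsTwoNonsimple I,
       ∃ Λ : Type u, CyclicIdeals.HasFormTwo (IsLocalRing.maximalIdeal R) Λ,
       ∃ Λ : Type u, CyclicIdeals.ProperIdealsHaveForms R Λ,
       ∀ I : Ideal R, CyclicIdeals.IsSummandOfDirectSumOfCyclics (R := R) I] ∧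
    (∀ Λ : Type u, CyclicIdeals.HasFormTwo (IsLocalRing.maximalIdeal R) Λ →
      CyclicIdeals.ProperIdealsHaveForms R Λ) ∧
    (∀ Λ : Type u, CyclicIdeals.ProperIdealsHaveForms R Λ →
      ∃ Γ : Type u, Cardinal.mk Γ ≤ Cardinal.mk Λ ∧
        CyclicIdeals.HasFormTwo (IsLocalRing.maximalIdeal R) Γ) ∧
    (∀ Λ : Type u, CyclicIdeals.ProperIdealsHaveForms R Λ →
      ∀ (I : Ideal R) (κ : Type u) (a : κ → R), (∀ k, a k ≠ 0) →
        CyclicIdeals.IsDirectSumOfSpans I a → Cardinal.mk κ ≤ Cardinal.mk Λ + 2) := by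
  refine ⟨?_, fun Λ => CyclicIdeals.properIdealsHaveForms_of_hasFormTwo,
    fun Λ h => h.exists_hasFormTwo, fun Λ h I κ a h0 ha => h.mk_le h0 ha⟩
  tfae_have 1 → 5 := fun h I => (h I).isSummand
  tfae_have 5 → 3 := fun h => CyclicIdeals.exists_hasFormTwo_of_hasCyclicSummands
    fun N => CyclicIdeals.hasCyclicSummands_of_isSummand (h N)
  tfae_have 3 → 4 := fun ⟨Λ, h⟩ => ⟨Λ, CyclicIdeals.properIdealsHaveForms_of_hasFormTwo h⟩
  tfae_have 4 → 2 := fun ⟨_, h⟩ => h.isDirectSumOfCyclicsTwoNonsimple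
  tfae_have 2 → 1 := fun h I => (h I).isDirectSumOfCyclics
  tfae_finish
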